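/- **Setting.** There are $K$ cells and $U$ agents. An action is a vector $\mathbf a\in\{0,1,\dots,U\}^K$ ($a_k=u\ge 1$: agent $u$ searches cell $k$; $a_k=0$: cell $k$ is not searched) such that $a_i=a_j=u\in\{1,\dots,U\}$, $i<j$, implies $a_k=u$ for all $i\le k\le j$; $\mathcal A$ is the set of actions. Known detection probabilities $\boldsymbol\gamma(\mathbf a)=(\gamma_1(\mathbf a),\dots,\gamma_K(\mathbf a))\in[0,1]^K$, $\mathbf a\in\mathcal A$, are given, with $\gamma_k(\mathbf a)>0$ whenever $a_k\neq 0$, and with $\gamma_k(\mathbf a)=\gamma_k(\mathbf b)$ for $i\le k\le j$ whenever some agent $u$ is assigned exactly the cells $i,\dots,j$ both in $\mathbf a$ and in $\mathbf b$. The unknown rates form a vector $\boldsymbol\lambda\in\mathbb R_+^K$, where $\mathbb R_+$ denotes $[0,\infty)$ throughout, or else $(0,\infty)$ throughout (the statement is made for either choice). In each round $t=1,2,\dots$ a policy $\pi$ chooses $\mathbf a_t\in\mathcal A$ as a function of the history $(\mathbf a_1,\mathbf Y_1,\dots,\mathbf a_{t-1},\mathbf Y_{t-1})$; then, independently of the past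 given $\mathbf a_t$ and independently over the cells $k$, $X_{kt}\sim\mathrm{Pois}(\lambda_k)$ events occur, and $Y_{kt}\mid X_{kt}\sim\mathrm{Bin}(X_{kt},\gamma_k(\mathbf a_t))$ of them are observed; $\mathbf Y_t=(Y_{1t},\dots,Y_{Kt})$. Let $\mathcal G=\{\boldsymbol\gamma(\mathbf a):\mathbf a\in\mathcal A\}$, $\mathbf g_t=\boldsymbol\gamma(\mathbf a_t)$, $\mathrm{opt}_{\boldsymbol\lambda}=\max_{\mathbf g\in\mathcal G}\mathbf g^T\boldsymbol\lambda$, $\Delta_{\mathbf g}=\mathrm{opt}_{\boldsymbol\lambda}-\mathbf g^T\boldsymbol\lambda$, and let $\mathrm{Reg}^\pi_{\boldsymbol\lambda}(n)=n\,\mathrm{opt}_{\boldsymbol\lambda}-\mathbb E_{\boldsymbol\lambda}\big(\sum_{t=1}^n\mathbf g_t^T\boldsymbol\lambda\big)$ be the regret. The policy $\pi$ is *uniformly good* if for every $\boldsymbol\lambda\in\mathbb R_+^K$, every $\mathbf g\in\mathcal G$ with $\Delta_{\mathbf g}>0$ and every $\alpha>0$ one has $\mathbb E_{\boldsymbol\lambda}\big(\sum_{t=1}^n\mathbb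 I\{\mathbf g_t=\mathbf g\}\big)=o(n^\alpha)$ as $n\to\infty$. Put $J(\boldsymbol\lambda)=\{\mathbf g\in\mathcal G:\mathbf g^T\boldsymbol\lambda=\mathrm{opt}_{\boldsymbol\lambda}\}$, $S(\boldsymbol\lambda)=\mathcal G\setminus J(\boldsymbol\lambda)$, $\mathcal I(\boldsymbol\lambda)=\{k:\exists\,\mathbf g\in J(\boldsymbol\lambda),\ g_k>0\}$ and $$B(\boldsymbol\lambda)=\{\boldsymbol\theta\in\mathbb R_+^K:\ \mathbf g^T\boldsymbol\theta<\mathrm{opt}_{\boldsymbol\theta}\ \ \forall\,\mathbf g\in J(\boldsymbol\lambda),\ \text{ and }\ \theta_k=\lambda_k\ \ \forall\,k\in\mathcal I(\boldsymbol\lambda)\}.$$ Let $\mathrm{kl}(\lambda,\theta)=\lambda\log(\lambda/\theta)+\theta-\lambda$ be the Kullback–Leibler divergence of the Poisson distributions with means $\lambda$ and $\theta$ (with $\mathrm{kl}(0,\theta)=\theta$, $\mathrm{kl}(\lambda,0)=\infty$ for $\lambda>0$, and $0\cdot\infty=0$). **Theorem.** For any $\boldsymbol\lambda\in\mathbb R_+^K$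 with $B(\boldsymbol\lambda)\ne\emptyset$ and any uniformly good policy $\pi$, $$\liminf_{n\to\infty}\frac{\mathrm{Reg}^\pi_{\boldsymbol\lambda}(n)}{\log n}\ \ge\ c(\boldsymbol\lambda),$$ where $c(\boldsymbol\lambda)$ is the optimal value of the problem $$\inf_{\mathbf d\ge \mathbf 0}\ \sum_{\mathbf g\in S(\boldsymbol\lambda)}d_{\mathbf g}\Delta_{\mathbf g}\qquad\text{such that}\qquad \inf_{\boldsymbol\theta\in B(\boldsymbol\lambda)}\ \sum_{\mathbf g\in S(\boldsymbol\lambda)}d_{\mathbf g}\sum_{k=1}^K g_k\,\mathrm{kl}(\lambda_k,\theta_k)\ \ge\ 1 .$$ -/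

import Mathlib

open MeasureTheory ProbabilityTheory Filter Asymptotics
open scoped NNReal ENNReal

noncomputable section

namespace Surveillance

/-- Deployments of the agents `1, …, U` over the cells: `a k = u` means that agent `u` searches
cell `k`, and `a k = 0` that cell `k` is not searched. An action is a deployment in which the cells
of every agent form a (possibly empty) interval. -/
abbrev Action (K U : ℕ) : Type :=
  {a : Fin K → Fin (U + 1) //
    ∀ i j : Fin K, i < j → a i = a j → a i ≠ 0 → ∀ k, i ≤ k → k ≤ j → a k = a i}

instance (K U : ℕ) : Nonempty (Action K U) := ⟨⟨fun _ => 0, fun _ _ _ _ h => absurd rfl h⟩⟩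

/-- Agent `u` is assigned to the cells `i, i + 1, …, j` only. -/
def IsAssigned {K U : ℕ} (a : Action K U) (i j : Fin K) (u : Fin (U + 1)) : Prop :=
  ∀ k, a.1 k = u ↔ i ≤ k ∧ k ≤ j

/-- The detection probabilities `γ_k(a)` of the actions. -/
structure Detection (K U : ℕ) where
  /-- the probability `γ_k(a)` that an event in cell `k` is detected under action `a` -/
  prob : Action K U → Fin K → unitInterval
  /-- the detection probability in a searched cell depends only on the agent that searches it and
  on the sub-region assigned to that agent -/
  local_eq : ∀ (a b : Action K U) (i j : Fin K) (u : Fin (U + 1)), u ≠ 0 → i ≤ j →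
    IsAssigned a i j u → IsAssigned b i j u → ∀ k, i ≤ k → k ≤ j → prob a k = prob b k
  /-- events in a searched cell are detected with positive probability -/
  pos : ∀ (a : Action K U) (k : Fin K), a.1 k ≠ 0 → 0 < prob a k

variable {K U : ℕ}

/-! ### The sequential problem -/

/-- The law of the number of detected events in one cell during one search: `X ~ Pois(r)` events
occur, and given `X` the number of detected ones is `Bin(X, p)`. -/
def cellLaw (r : ℝ≥0) (p : unitInterval) : Measure ℕ :=
  (poissonMeasure r).bind fun x => binomial x p

/-- The law of the vector of detected events in one round with rates `lam` and detection
probabilities `g`; the cells are independent. -/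
def obsLaw (lam : Fin K → ℝ≥0) (g : Fin K → unitInterval) : Measure (Fin K → ℕ) :=
  Measure.pi fun k => cellLaw (lam k) (g k)

/-- Histories of `t` rounds: the actions taken and the vectors of events observed. -/
abbrev History (K U t : ℕ) : Type := Fin t → Action K U × (Fin K → ℕ)

/-- A policy chooses the next action as a function of the history so far. -/
abbrev Policy (K U : ℕ) : Type := (t : ℕ) → History K U t → Action K U

/-- The law of the history of the first `t` rounds when policy `π` is used and the rates
are `lam`. -/
def histLaw (γ : Detection K U) (π : Policy K U) (lam : Fin K → ℝ≥0) :
    (t : ℕ) → Measure (History K U t)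
  | 0 => Measure.dirac Fin.elim0
  | t + 1 => (histLaw γ π lam t).bind fun h =>
      (obsLaw lam (γ.prob (π t h))).map fun y => Fin.snoc h (π t h, y)

/-- The expected reward `gᵀ λ` of the detection probability vector `g`. -/
def reward (lam : Fin K → ℝ≥0) (g : Fin K → unitInterval) : ℝ :=
  ∑ k, (g k : ℝ) * (lam k : ℝ)

/-- The largest expected reward of an action (a maximum over a finite nonempty set). -/
def opt (γ : Detection K U) (lam : Fin K → ℝ≥0) : ℝ :=
  ⨆ a : Action K U, reward lam (γ.prob a)

/-- The optimality gap `Δ_g`. -/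
def gap (γ : Detection K U) (lam : Fin K → ℝ≥0) (g : Fin K → unitInterval) : ℝ :=
  opt γ lam - reward lam g

/-- The regret of policy `π` up to the horizon `n`. -/
def regret (γ : Detection K U) (π : Policy K U) (lam : Fin K → ℝ≥0) (n : ℕ) : ℝ :=
  n * opt γ lam - ∫ h, ∑ t : Fin n, reward lam (γ.prob (h t).1) ∂(histLaw γ π lam n)

open Classical in
/-- The expected number of rounds among the first `n` in which the detection probability
vector `g` is selected. -/
def expectedPlays (γ : Detection K U) (π : Policy K U) (lam : Fin K → ℝ≥0) (n : ℕ)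
    (g : Fin K → unitInterval) : ℝ :=
  ∫ h, ∑ t : Fin n, (if γ.prob (h t).1 = g then (1 : ℝ) else 0) ∂(histLaw γ π lam n)

open Classical in
/-- The set of detection probability vectors of the actions. -/
def vectors (γ : Detection K U) : Finset (Fin K → unitInterval) :=
  Finset.univ.image γ.prob

/-- A policy is uniformly good, for rates in the range `R`, if for all rate vectors every
suboptimal vector is selected `o(n ^ α)` times in expectation, for all `α > 0`. -/
def IsUniformlyGood (R : Set ℝ≥0) (γ : Detection K U) (π : Policy K U) : Prop :=
  ∀ lam : Fin K → ℝ≥0, (∀ k, lam k ∈ R) → ∀ g ∈ vectors γ, 0 < gap γ lam g →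
    ∀ α : ℝ, 0 < α →
      (fun n : ℕ => expectedPlays γ π lam n g) =o[atTop] fun n : ℕ => (n : ℝ) ^ α

/-! ### The constant in the lower bound -/

open Classical in
/-- The optimal vectors `J(λ)`. -/
def optimalVectors (γ : Detection K U) (lam : Fin K → ℝ≥0) : Finset (Fin K → unitInterval) :=
  (vectors γ).filter fun g => reward lam g = opt γ lam

open Classical in
/-- The suboptimal vectors `S(λ)`. -/
def suboptimalVectors (γ : Detection K U) (lam : Fin K → ℝ≥0) :
    Finset (Fin K → unitInterval) :=
  vectors γ \ optimalVectors γ lam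

/-- The cells `I(λ)` in which some optimal vector has a positive detection probability. -/
def optimalCells (γ : Detection K U) (lam : Fin K → ℝ≥0) : Set (Fin K) :=
  {k | ∃ g ∈ optimalVectors γ lam, 0 < g k}

/-- The set `B(λ)` of the rate vectors `θ`, with entries in the range `R`, for which all vectors
in `J(λ)` are suboptimal and which agree with `λ` on the cells `I(λ)`. -/
def confusingRates (R : Set ℝ≥0) (γ : Detection K U) (lam : Fin K → ℝ≥0) :
    Set (Fin K → ℝ≥0) :=
  {θ | (∀ k, θ k ∈ R) ∧ (∀ g ∈ optimalVectors γ lam, reward θ g < opt γ θ) ∧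
    ∀ k ∈ optimalCells γ lam, θ k = lam k}

open Classical in
/-- The divergence `kl(x, y) = x log (x / y) + y - x` of the Poisson distributions with means `x`
and `y`, with the usual conventions `kl(0, y) = y` and `kl(x, 0) = ∞` for `x > 0`. -/
def poissonKL (x y : ℝ≥0) : ℝ≥0∞ :=
  if y = 0 ∧ x ≠ 0 then ⊤
  else ENNReal.ofReal ((x : ℝ) * Real.log ((x : ℝ) / (y : ℝ)) + (y : ℝ) - (x : ℝ))

/-- Feasibility of the play rates `d` in the optimisation problem that defines `c(λ)`. Only the
values of `d` on `S(λ)` matter. -/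
def IsFeasible (R : Set ℝ≥0) (γ : Detection K U) (lam : Fin K → ℝ≥0)
    (d : (Fin K → unitInterval) → ℝ≥0) : Prop :=
  1 ≤ ⨅ θ ∈ confusingRates R γ lam, ∑ g ∈ suboptimalVectors γ lam,
    (d g : ℝ≥0∞) * ∑ k, ENNReal.ofReal (g k : ℝ) * poissonKL (lam k) (θ k)

/-- The optimal value `c(λ)`. -/
def lowerBoundConstant (R : Set ℝ≥0) (γ : Detection K U) (lam : Fin K → ℝ≥0) : EReal :=
  ⨅ (d : (Fin K → unitInterval) → ℝ≥0) (_ : IsFeasible R γ lam d),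
    ((∑ g ∈ suboptimalVectors γ lam, (d g : ℝ) * gap γ lam g : ℝ) : EReal)

end Surveillance

end

noncomputable section

namespace Surveillance

/-! This is a Graves–Lai argument. A rate vector θ in B(λ) agrees with λ on I(λ), so only plays of
suboptimal vectors tell the two apart. When θ vanishes only where λ does, the chain rule
(`entropyBound_histLaw`) bounds the relative entropy of the n-round histories by the sum over g in
S(λ) of the expected plays of g times Σ g_k kl(λ_k, θ_k). A uniformly good policy plays J(λ) almost
always under λ, but only o(n^α) times under θ. Testing the entropy against a multiple of the
fraction of rounds spent in J(λ) (`mul_one_sub_le`) forces it to be at least about log n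
(`one_le_sum_of_tendsto`). Hence every limit d of the plays divided by log n is feasible
(`isFeasible_of_tendsto`), and by `regret_eq` the regret divided by log n then tends to the
objective value of d.

Entropy enters only in variational form with bounded test functions, so no densities of history laws
are needed; discreteness makes measurability automatic. -/

/-- `D` bounds the relative entropy of `P` with respect to `Q`, in the variational form of
Donsker and Varadhan. -/
def EntropyBound {α : Type*} [MeasurableSpace α] (P Q : Measure α) (D : ℝ) : Prop :=
  ∀ f : α → ℝ, (∃ C, ∀ x, |f x| ≤ C) → ∫ x, f x ∂P ≤ D + Real.log (∫ x, Real.exp (f x) ∂Q)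

/-! ### Calculus of entropy bounds on discrete spaces. -/

section Discrete

variable {α β : Type*} [MeasurableSpace α] [DiscreteMeasurableSpace α] [MeasurableSpace β]

lemma integrable_of_abs_le {P : Measure α} [IsFiniteMeasure P] {f : α → ℝ} {C : ℝ}
    (hf : ∀ x, |f x| ≤ C) : Integrable f P :=
  Integrable.of_bound Measurable.of_discrete.aestronglyMeasurable C (ae_of_all _ hf)

lemma integrable_exp_of_abs_le {P : Measure α} [IsFiniteMeasure P] {f : α → ℝ} {C : ℝ}
    (hf : ∀ x, |f x| ≤ C) : Integrable (fun x => Real.exp (f x)) P :=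
  integrable_of_abs_le (C := Real.exp C) fun x => by
    rw [abs_of_pos (Real.exp_pos _)]
    exact Real.exp_le_exp.2 (le_of_abs_le (hf x))

lemma integral_bind_of_abs_le [DiscreteMeasurableSpace β] {P : Measure α} [IsProbabilityMeasure P] {κ : α → Measure β}
    [∀ a, IsProbabilityMeasure (κ a)] {f : β → ℝ} {C : ℝ} (hf : ∀ x, |f x| ≤ C) :
    ∫ y, f y ∂(P.bind κ) = ∫ x, ∫ y, f y ∂κ x ∂P := by
  let κ' : Kernel α β := ⟨κ, Measurable.of_discrete⟩
  have : IsMarkovKernel κ' := ⟨fun a => inferInstanceAs (IsProbabilityMeasure (κ a))⟩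
  have h : P.bind κ = (κ' ∘ₖ Kernel.const Unit P) () := by
    rw [Kernel.comp_apply, Kernel.const_apply]; rfl
  have hint := integrable_of_abs_le (P := (κ' ∘ₖ Kernel.const Unit P) ()) hf
  rw [h, Kernel.integral_comp hint, Kernel.const_apply]
  rfl

lemma isProbabilityMeasure_bind {P : Measure α} [IsProbabilityMeasure P] {κ : α → Measure β}
    [∀ a, IsProbabilityMeasure (κ a)] : IsProbabilityMeasure (P.bind κ) := by
  let κ' : Kernel α β := ⟨κ, Measurable.of_discrete⟩
  have : IsMarkovKernel κ' := ⟨fun a => inferInstanceAs (IsProbabilityMeasure (κ a))⟩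
  exact inferInstanceAs (IsProbabilityMeasure (κ' ∘ₘ P))

lemma exp_neg_le_integral_exp {P : Measure α} [IsProbabilityMeasure P] {f : α → ℝ} {C : ℝ}
    (hf : ∀ x, |f x| ≤ C) : Real.exp (-C) ≤ ∫ x, Real.exp (f x) ∂P := by
  have h := integral_mono (μ := P) (integrable_const (Real.exp (-C)))
    (integrable_exp_of_abs_le hf) fun x => Real.exp_le_exp.2 (neg_le_of_abs_le (hf x))
  simpa using h

lemma integral_exp_le_exp {P : Measure α} [IsProbabilityMeasure P] {f : α → ℝ} {C : ℝ}
    (hf : ∀ x, |f x| ≤ C) : ∫ x, Real.exp (f x) ∂P ≤ Real.exp C := by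
  have h := integral_mono (μ := P) (integrable_exp_of_abs_le hf)
    (integrable_const (Real.exp C)) fun x => Real.exp_le_exp.2 (le_of_abs_le (hf x))
  simpa using h

lemma abs_log_integral_exp_le {P : Measure α} [IsProbabilityMeasure P] {f : α → ℝ} {C : ℝ}
    (hf : ∀ x, |f x| ≤ C) : |Real.log (∫ x, Real.exp (f x) ∂P)| ≤ C := by
  have h := exp_neg_le_integral_exp (P := P) hf
  have h0 := (Real.exp_pos _).trans_le h
  exact abs_le.2 ⟨(Real.le_log_iff_exp_le h0).2 h,
    (Real.log_le_iff_le_exp h0).2 (integral_exp_le_exp hf)⟩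

lemma EntropyBound.map [DiscreteMeasurableSpace β] {P Q : Measure α} {D : ℝ} (h : EntropyBound P Q D) (g : α → β) :
    EntropyBound (P.map g) (Q.map g) D := by
  rintro f ⟨C, hC⟩
  rw [integral_map Measurable.of_discrete.aemeasurable
      Measurable.of_discrete.aestronglyMeasurable,
    integral_map Measurable.of_discrete.aemeasurable
      Measurable.of_discrete.aestronglyMeasurable]
  exact h _ ⟨C, fun x => hC _⟩

/-- The chain rule for the relative entropy. -/
lemma EntropyBound.bind [DiscreteMeasurableSpace β] {P Q : Measure α} [IsProbabilityMeasure P] [IsProbabilityMeasure Q]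
    {D : ℝ} (h : EntropyBound P Q D) {κ η : α → Measure β} [∀ a, IsProbabilityMeasure (κ a)]
    [∀ a, IsProbabilityMeasure (η a)] {E : α → ℝ} (hE : ∃ C, ∀ x, |E x| ≤ C)
    (hκ : ∀ a, EntropyBound (κ a) (η a) (E a)) :
    EntropyBound (P.bind κ) (Q.bind η) (D + ∫ x, E x ∂P) := by
  rintro f ⟨C, hC⟩
  obtain ⟨C', hC'⟩ := hE
  have hexp : ∀ y, |Real.exp (f y)| ≤ Real.exp C := fun y => by
    rw [abs_of_pos (Real.exp_pos _)]
    exact Real.exp_le_exp.2 (le_of_abs_le (hC y))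
  rw [integral_bind_of_abs_le hC, integral_bind_of_abs_le hexp]
  have hF : ∀ x, |Real.log (∫ y, Real.exp (f y) ∂η x)| ≤ C :=
    fun x => abs_log_integral_exp_le hC
  -- The conditional log-Laplace transform of `f` is itself a bounded test function for the first
  -- stage.
  have h1 := h _ ⟨C, hF⟩
  have h2 : ∫ x, ∫ y, f y ∂κ x ∂P ≤
      ∫ x, (E x + Real.log (∫ y, Real.exp (f y) ∂η x)) ∂P := by
    refine integral_mono (integrable_of_abs_le (C := C) fun x => ?_)
      ((integrable_of_abs_le hC').add (integrable_of_abs_le hF)) fun x => hκ x f ⟨C, hC⟩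
    simpa using norm_integral_le_of_norm_le_const (μ := κ x) (f := f) (ae_of_all _ hC)
  rw [integral_add (integrable_of_abs_le hC') (integrable_of_abs_le hF)] at h2
  have h3 : ∀ x, Real.exp (Real.log (∫ y, Real.exp (f y) ∂η x)) =
      ∫ y, Real.exp (f y) ∂η x := fun x =>
    Real.exp_log ((Real.exp_pos _).trans_le (exp_neg_le_integral_exp hC))
  simp only [h3] at h1
  linarith

/-- A product is a two-stage experiment whose second stage ignores the first, so the chain rule
applies with constant cost. -/
lemma EntropyBound.prod [DiscreteMeasurableSpace β] [Countable α] [Countable β]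
    {P Q : Measure α} [IsProbabilityMeasure P] [IsProbabilityMeasure Q]
    {P' Q' : Measure β} [IsProbabilityMeasure P'] [IsProbabilityMeasure Q'] {D D' : ℝ}
    (h : EntropyBound P Q D) (h' : EntropyBound P' Q' D') :
    EntropyBound (P.prod P') (Q.prod Q') (D + D') := by
  have hp (R : Measure β) [IsProbabilityMeasure R] (x : α) :
      IsProbabilityMeasure (R.map (Prod.mk x)) :=
    Measure.isProbabilityMeasure_map Measurable.of_discrete.aemeasurable
  have := h.bind (E := fun _ => D') (κ := fun x => P'.map (Prod.mk x))
    (η := fun x => Q'.map (Prod.mk x)) ⟨|D'|, fun _ => le_rfl⟩ fun x => h'.map _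
  simpa [Measure.prod] using this

lemma EntropyBound.pi [Countable α] :
    ∀ {n : ℕ} {P Q : Fin n → Measure α} [∀ k, IsProbabilityMeasure (P k)]
    [∀ k, IsProbabilityMeasure (Q k)] {D : Fin n → ℝ} (_ : ∀ k, EntropyBound (P k) (Q k) (D k)),
    EntropyBound (Measure.pi P) (Measure.pi Q) (∑ k, D k) := by
  intro n
  induction n with
  | zero =>
    intro P Q _ _ D _ f _
    have h : ∀ g : (Fin 0 → α) → ℝ, g = fun _ => g default := fun g =>
      funext fun x => congrArg g (Subsingleton.elim _ _)
    rw [h f]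
    simp
  | succ n ih =>
    intro P Q _ _ D h
    have hP := (measurePreserving_piFinSuccAbove P 0).symm.map_eq
    have hQ := (measurePreserving_piFinSuccAbove Q 0).symm.map_eq
    have := ((h 0).prod (ih fun k => h (Fin.succAbove 0 k))).map
      (MeasurableEquiv.piFinSuccAbove (fun _ => α) 0).symm
    rw [hP, hQ] at this
    simpa [Fin.sum_univ_succ] using this

end Discrete

/-! ### Poisson laws -/

lemma hasSum_poisson_mean (r : ℝ≥0) :
    HasSum (fun n : ℕ => Real.exp (-r) * r ^ n / n.factorial * n) (r : ℝ) := by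
  rw [← hasSum_nat_add_iff' 1]
  have h := (hasSum_one_poissonMeasure r).mul_left (r : ℝ)
  simp only [Finset.range_one, Finset.sum_singleton, Nat.cast_zero, mul_zero, sub_zero]
  rw [mul_one] at h
  refine Eq.subst (motive := fun u => HasSum u (r : ℝ)) (funext fun n => ?_) h
  rw [Nat.factorial_succ, pow_succ]
  push_cast
  field_simp

/-- Gibbs' inequality: apply `1 + x ≤ exp x` to the log-ratio of the tilted law `exp f / Z` times
Pois(b) and Pois(a), then sum against Pois(a). -/
lemma entropyBound_poisson {a b : ℝ≥0} (hab : b = 0 → a = 0) :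
    EntropyBound (poissonMeasure a) (poissonMeasure b)
      (a * Real.log (a / b) + b - a) := by
  rintro f ⟨C, hC⟩
  have hQ := hasSum_integral_poissonMeasure (r := b) (integrable_exp_of_abs_le hC)
  have hZ := (Real.exp_pos _).trans_le (exp_neg_le_integral_exp (P := poissonMeasure b) hC)
  set Z := ∫ x, Real.exp (f x) ∂(poissonMeasure b)
  have hP := hasSum_integral_poissonMeasure (r := a) (integrable_of_abs_le hC)
  rcases eq_or_ne a 0 with rfl | ha
  -- Pois(0) is the point mass at 0, so the term n = 0 of `Z` suffices.
  · have h0 := hP.unique (hasSum_single 0 fun n hn => by simp [hn])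
    have h1 : Real.exp (-b) * Real.exp (f 0) ≤ Z := by
      simpa using le_hasSum hQ 0 fun n _ => by positivity
    have h2 : -b + f 0 ≤ Real.log Z := by
      rwa [Real.le_log_iff_exp_le hZ, Real.exp_add]
    simp at h0
    rw [h0]
    simp
    linarith
  · have hb : b ≠ 0 := fun h => ha (hab h)
    have ha' : (0 : ℝ) < a := by positivity
    have hb' : (0 : ℝ) < b := by positivity
    have h1 := hasSum_one_poissonMeasure a
    have hm := (hasSum_poisson_mean a).mul_right (Real.log (a / b))
    have hL := ((hP.sub hm).add (h1.mul_right (1 - Real.log Z - b + a)))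
    have hR := hQ.div_const Z
    rw [div_self hZ.ne'] at hR
    have := hasSum_le (fun n => ?_) hL hR
    · linarith
    · have hw := Real.add_one_le_exp (f n - Real.log Z - n * Real.log (a / b) - b + a)
      have hp : 0 < Real.exp (-a) * (a : ℝ) ^ n / n.factorial := by positivity
      have hq : Real.exp (f n - Real.log Z - n * Real.log (a / b) - b + a) =
          Real.exp (f n) / Z * (b / a) ^ n * Real.exp (-b) / Real.exp (-a) := by
        rw [Real.exp_add, Real.exp_sub, Real.exp_sub, Real.exp_sub, Real.exp_log hZ,
          Real.exp_nat_mul, Real.exp_log (by positivity), Real.exp_neg, Real.exp_neg, div_pow,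
          div_pow]
        field_simp
      have := mul_le_mul_of_nonneg_left hw hp.le
      rw [hq] at this
      calc _ = Real.exp (-a) * (a : ℝ) ^ n / n.factorial *
            (f n - Real.log Z - n * Real.log (a / b) - b + a + 1) := by
              simp only [smul_eq_mul]; ring
        _ ≤ _ := this
        _ = _ := by simp only [smul_eq_mul, div_pow]; field_simp

/-- Thinning of a Poisson law. -/
lemma cellLaw_eq_poissonMeasure (r : ℝ≥0) (p : unitInterval) :
    cellLaw r p = poissonMeasure (r * unitInterval.toNNReal p) := by
  refine Measure.ext_of_singleton fun i => ?_
  have hp0 := p.2.1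
  have hp1 : (0 : ℝ) ≤ 1 - p := sub_nonneg.2 p.2.2
  rw [cellLaw, Measure.bind_apply (measurableSet_singleton i) Measurable.of_discrete.aemeasurable,
    poissonMeasure_singleton, lintegral_countable']
  simp only [poissonMeasure_singleton, binomial_singleton]
  have hnn : ∀ x : ℕ, 0 ≤ (x.choose i : ℝ) * p ^ i * (1 - p) ^ (x - i) *
      (Real.exp (-r) * r ^ x / x.factorial) := fun x => by positivity
  -- Terms with x < i vanish; with x = m + i, what remains is the mass function in m of the
  -- undetected events, Pois(r(1 - p)).
  have hs : HasSum (fun x : ℕ => (x.choose i : ℝ) * p ^ i * (1 - p) ^ (x - i) *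
      (Real.exp (-r) * r ^ x / x.factorial))
      (Real.exp (-(r * p)) * (r * p) ^ i / i.factorial) := by
    rw [← hasSum_nat_add_iff' i, Finset.sum_eq_zero, sub_zero]
    · have h := (hasSum_one_poissonMeasure (r * ⟨1 - p, hp1⟩)).mul_left
        (Real.exp (-(r * p)) * (r * p) ^ i / i.factorial)
      rw [mul_one] at h
      refine Eq.subst (motive := fun u => HasSum u _) (funext fun m => ?_) h
      symm
      have hc : (((m + i).choose i : ℕ) : ℝ) =
          ((m + i).factorial : ℕ) / ((m.factorial : ℕ) * (i.factorial : ℕ)) := by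
        rw [Nat.add_choose, Nat.cast_div (Nat.factorial_mul_factorial_dvd_factorial_add m i)
          (by positivity)]
        push_cast; rfl
      have he : Real.exp (-(r : ℝ)) = Real.exp (-(r * p)) * Real.exp (-(r * (1 - p))) := by
        rw [← Real.exp_add]; ring_nf
      rw [hc, he, Nat.add_sub_cancel]
      change _ = _ * (Real.exp (-(r * (1 - p))) * (r * (1 - p)) ^ m / m.factorial)
      rw [mul_pow, mul_pow, pow_add]
      field_simp
    · intro x hx
      simp [Nat.choose_eq_zero_of_lt (Finset.mem_range.1 hx)]
  have := hs.tsum_eq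
  calc _ = ∑' x : ℕ, ENNReal.ofReal ((x.choose i : ℝ) * p ^ i * (1 - p) ^ (x - i) *
      (Real.exp (-r) * r ^ x / x.factorial)) := by
        refine tsum_congr fun x => (ENNReal.ofReal_mul (by positivity)).symm
    _ = _ := by
        rw [← ENNReal.ofReal_tsum_of_nonneg hnn hs.summable, hs.tsum_eq]
        rfl

instance (r : ℝ≥0) (p : unitInterval) : IsProbabilityMeasure (cellLaw r p) := by
  rw [cellLaw_eq_poissonMeasure]
  infer_instance

variable {K U : ℕ}

instance (lam : Fin K → ℝ≥0) (g : Fin K → unitInterval) :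
    IsProbabilityMeasure (obsLaw lam g) := by
  unfold obsLaw
  infer_instance

/-- The divergence of the Poisson distributions, as a real number. -/
def realKL (x y : ℝ≥0) : ℝ := x * Real.log (x / y) + y - x

/-- After thinning both means carry the factor g_k, which cancels in the log-ratio; the divergence
is thus linear in g_k. -/
lemma entropyBound_obsLaw {lam θ : Fin K → ℝ≥0} (h : ∀ k, θ k = 0 → lam k = 0)
    (g : Fin K → unitInterval) :
    EntropyBound (obsLaw lam g) (obsLaw θ g) (∑ k, (g k : ℝ) * realKL (lam k) (θ k)) := by
  refine EntropyBound.pi fun k => ?_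
  rw [cellLaw_eq_poissonMeasure, cellLaw_eq_poissonMeasure]
  have := entropyBound_poisson (a := lam k * unitInterval.toNNReal (g k))
    (b := θ k * unitInterval.toNNReal (g k)) fun h0 => by
      rcases mul_eq_zero.1 h0 with h0 | h0
      · rw [h k h0, zero_mul]
      · rw [h0, mul_zero]
  convert this using 1
  push_cast
  rw [unitInterval.coe_toNNReal, realKL]
  rcases eq_or_ne (g k : ℝ) 0 with h0 | h0
  · simp [h0]
  · rw [mul_div_mul_right _ _ h0]
    ring

/-! ### Laws of histories. -/

instance (γ : Detection K U) (π : Policy K U) (lam : Fin K → ℝ≥0) (t : ℕ) :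
    IsProbabilityMeasure (histLaw γ π lam t) := by
  induction t with
  | zero => unfold histLaw; infer_instance
  | succ t ih =>
    have (h : History K U t) : IsProbabilityMeasure ((obsLaw lam (γ.prob (π t h))).map
        fun y => (Fin.snoc h (π t h, y) : History K U (t + 1))) :=
      Measure.isProbabilityMeasure_map Measurable.of_discrete.aemeasurable
    exact isProbabilityMeasure_bind

lemma exists_abs_sum_le {t : ℕ} (F : Action K U → ℝ) :
    ∃ C, ∀ h : History K U t, |∑ i, F (h i).1| ≤ C :=
  ⟨∑ _ : Fin t, ∑ a, |F a|, fun _ => (Finset.abs_sum_le_sum_abs _ _).trans <|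
    Finset.sum_le_sum fun _ _ =>
      Finset.single_le_sum (f := fun a => |F a|) (fun _ _ => abs_nonneg _) (Finset.mem_univ _)⟩

lemma integral_histLaw_succ (γ : Detection K U) (π : Policy K U) (lam : Fin K → ℝ≥0) (t : ℕ)
    (F : Action K U → ℝ) :
    ∫ h, ∑ i, F (h i).1 ∂(histLaw γ π lam (t + 1)) =
      ∫ h, ∑ i, F (h i).1 ∂(histLaw γ π lam t) + ∫ h, F (π t h) ∂(histLaw γ π lam t) := by
  have (h : History K U t) : IsProbabilityMeasure ((obsLaw lam (γ.prob (π t h))).map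
      fun y => (Fin.snoc h (π t h, y) : History K U (t + 1))) :=
    Measure.isProbabilityMeasure_map Measurable.of_discrete.aemeasurable
  obtain ⟨C, hC⟩ := exists_abs_sum_le (t := t + 1) F
  obtain ⟨C', hC'⟩ := exists_abs_sum_le (t := t) F
  rw [histLaw, integral_bind_of_abs_le hC, ← integral_add (integrable_of_abs_le hC')]
  · refine integral_congr_ae (ae_of_all _ fun h => ?_)
    simp only
    rw [integral_map Measurable.of_discrete.aemeasurable
      Measurable.of_discrete.aestronglyMeasurable]
    simp [Fin.sum_univ_castSucc]
  · exact integrable_of_abs_le (C := ∑ a, |F a|) fun h =>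
      Finset.single_le_sum (f := fun a => |F a|) (fun _ _ => abs_nonneg _) (Finset.mem_univ _)

/-- The relative entropy of the laws of the history for two rate vectors. -/
lemma entropyBound_histLaw (γ : Detection K U) (π : Policy K U) {lam θ : Fin K → ℝ≥0}
    (hθ : ∀ k, θ k = 0 → lam k = 0) (t : ℕ) :
    EntropyBound (histLaw γ π lam t) (histLaw γ π θ t)
      (∫ h, ∑ i, ∑ k, (γ.prob (h i).1 k : ℝ) * realKL (lam k) (θ k) ∂(histLaw γ π lam t)) := by
  induction t with
  | zero =>
    rintro f ⟨C, hC⟩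
    simp [histLaw]
  | succ t ih =>
    rw [integral_histLaw_succ γ π lam t
      fun a => ∑ k, (γ.prob a k : ℝ) * realKL (lam k) (θ k)]
    have hp (ρ : Fin K → ℝ≥0) (h : History K U t) :
        IsProbabilityMeasure ((obsLaw ρ (γ.prob (π t h))).map
          fun y => (Fin.snoc h (π t h, y) : History K U (t + 1))) :=
      Measure.isProbabilityMeasure_map Measurable.of_discrete.aemeasurable
    -- Appending the new round to a fixed history is a push-forward, which preserves the bound.
    exact ih.bind ⟨_, fun h => Finset.single_le_sum
      (f := fun a => |∑ k, (γ.prob a k : ℝ) * realKL (lam k) (θ k)|)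
      (fun _ _ => abs_nonneg _) (Finset.mem_univ (π t h))⟩
      fun h => (entropyBound_obsLaw hθ _).map _

/-! ### Expected plays and the regret. -/

lemma mem_vectors (γ : Detection K U) (a : Action K U) : γ.prob a ∈ vectors γ := by
  simp [vectors]

lemma expectedPlays_nonneg (γ : Detection K U) (π : Policy K U) (lam : Fin K → ℝ≥0) (n : ℕ)
    (g : Fin K → unitInterval) : 0 ≤ expectedPlays γ π lam n g :=
  integral_nonneg fun _ => Finset.sum_nonneg fun _ _ => by split_ifs <;> norm_num

lemma integral_sum_eq_sum_expectedPlays (γ : Detection K U) (π : Policy K U)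
    (lam : Fin K → ℝ≥0) (n : ℕ) (F : (Fin K → unitInterval) → ℝ) :
    ∫ h, ∑ i, F (γ.prob (h i).1) ∂(histLaw γ π lam n) =
      ∑ g ∈ vectors γ, expectedPlays γ π lam n g * F g := by
  classical
  have h (h : History K U n) : ∑ i, F (γ.prob (h i).1) =
      ∑ g ∈ vectors γ, (∑ i, if γ.prob (h i).1 = g then (1 : ℝ) else 0) * F g := by
    simp_rw [Finset.sum_mul]
    rw [Finset.sum_comm]
    refine Finset.sum_congr rfl fun i _ => ?_
    simp [mem_vectors]
  simp_rw [h]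
  rw [integral_finsetSum]
  · refine Finset.sum_congr rfl fun g _ => ?_
    rw [integral_mul_const, expectedPlays]
  · intro g _
    obtain ⟨C, hC⟩ := exists_abs_sum_le (t := n)
      fun a : Action K U => if γ.prob a = g then (1 : ℝ) else 0
    exact (integrable_of_abs_le hC).mul_const _

lemma sum_expectedPlays (γ : Detection K U) (π : Policy K U) (lam : Fin K → ℝ≥0) (n : ℕ) :
    ∑ g ∈ vectors γ, expectedPlays γ π lam n g = n := by
  simpa using (integral_sum_eq_sum_expectedPlays γ π lam n fun _ => 1).symm

lemma optimalVectors_subset (γ : Detection K U) (lam : Fin K → ℝ≥0) :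
    optimalVectors γ lam ⊆ vectors γ := by
  classical exact Finset.filter_subset _ _

lemma sum_suboptimal_add_sum_optimal (γ : Detection K U) (lam : Fin K → ℝ≥0)
    (F : (Fin K → unitInterval) → ℝ) :
    ∑ g ∈ suboptimalVectors γ lam, F g + ∑ g ∈ optimalVectors γ lam, F g =
      ∑ g ∈ vectors γ, F g := by
  classical
  rw [← Finset.sum_sdiff (optimalVectors_subset γ lam), suboptimalVectors]

lemma reward_le_opt (γ : Detection K U) (lam : Fin K → ℝ≥0) {g : Fin K → unitInterval}
    (hg : g ∈ vectors γ) : reward lam g ≤ opt γ lam := by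
  obtain ⟨a, rfl⟩ : ∃ a, γ.prob a = g := by simpa [vectors] using hg
  exact le_ciSup (f := fun a => reward lam (γ.prob a)) (Set.finite_range _).bddAbove a

lemma mem_suboptimalVectors {γ : Detection K U} {lam : Fin K → ℝ≥0} {g : Fin K → unitInterval} :
    g ∈ suboptimalVectors γ lam ↔ g ∈ vectors γ ∧ 0 < gap γ lam g := by
  simp only [suboptimalVectors, optimalVectors, Finset.mem_sdiff, Finset.mem_filter, not_and, gap,
    sub_pos]
  constructor
  · rintro ⟨h1, h2⟩
    exact ⟨h1, (reward_le_opt γ lam h1).lt_of_ne (h2 h1)⟩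
  · rintro ⟨h1, h2⟩
    exact ⟨h1, fun _ => h2.ne⟩

lemma gap_eq_zero_of_mem_optimalVectors {γ : Detection K U} {lam : Fin K → ℝ≥0}
    {g : Fin K → unitInterval} (hg : g ∈ optimalVectors γ lam) : gap γ lam g = 0 := by
  classical
  rw [gap, (Finset.mem_filter.1 hg).2, sub_self]

/-- The regret decomposition. -/
lemma regret_eq (γ : Detection K U) (π : Policy K U) (lam : Fin K → ℝ≥0) (n : ℕ) :
    regret γ π lam n =
      ∑ g ∈ suboptimalVectors γ lam, expectedPlays γ π lam n g * gap γ lam g := by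
  have h : ∑ g ∈ optimalVectors γ lam, expectedPlays γ π lam n g * gap γ lam g = 0 :=
    Finset.sum_eq_zero fun g hg => by rw [gap_eq_zero_of_mem_optimalVectors hg, mul_zero]
  have h' := sum_suboptimal_add_sum_optimal γ lam
    fun g => expectedPlays γ π lam n g * gap γ lam g
  rw [h, add_zero] at h'
  rw [h', regret, integral_sum_eq_sum_expectedPlays γ π lam n (reward lam),
    ← sum_expectedPlays γ π lam n, Finset.sum_mul, ← Finset.sum_sub_distrib]
  exact Finset.sum_congr rfl fun g _ => by rw [gap]; ring

/-! ### Change of measure. -/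

/-- On [0, 1] the convex function z ↦ exp(az) lies below its chord 1 - z + z exp(a). -/
lemma exp_mul_le_one_add {a z : ℝ} (h0 : 0 ≤ z) (h1 : z ≤ 1) :
    Real.exp (a * z) ≤ 1 + Real.exp a * z := by
  have h := convexOn_exp.2 (Set.mem_univ a) (Set.mem_univ 0) h0 (sub_nonneg.2 h1) (by ring)
  simp only [smul_eq_mul, mul_zero, add_zero, Real.exp_zero, mul_one] at h
  rw [mul_comm a z]
  nlinarith

/-- Change of measure from `lam` to `θ`, when the optimal vectors for `lam` do not distinguish the
two. -/
lemma mul_one_sub_le (γ : Detection K U) (π : Policy K U) {lam θ : Fin K → ℝ≥0}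
    (hθ : ∀ k, θ k = 0 → lam k = 0) (hI : ∀ k ∈ optimalCells γ lam, θ k = lam k) {n : ℕ}
    (hn : 0 < n) (a : ℝ) :
    a * (1 - ∑ g ∈ suboptimalVectors γ lam, expectedPlays γ π lam n g / n) ≤
      ∑ g ∈ suboptimalVectors γ lam,
          expectedPlays γ π lam n g * ∑ k, (g k : ℝ) * realKL (lam k) (θ k) +
        Real.log (1 + Real.exp a *
          ∑ g ∈ optimalVectors γ lam, expectedPlays γ π θ n g / n) := by
  classical
  have hn' : (0 : ℝ) < n := by exact_mod_cast hn
  let F : (Fin K → unitInterval) → ℝ := fun g => if g ∈ optimalVectors γ lam then 1 / n else 0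
  -- `Z` is the fraction of rounds in which a vector of J(λ) is played.
  let Z : History K U n → ℝ := fun h => ∑ i, F (γ.prob (h i).1)
  have hF (g) : 0 ≤ F g ∧ F g ≤ 1 / n := by
    simp only [F]
    split_ifs <;> simp
  have hZ0 (h) : 0 ≤ Z h := Finset.sum_nonneg fun _ _ => (hF _).1
  have hZ1 (h) : Z h ≤ 1 := by
    calc Z h ≤ ∑ _ : Fin n, (1 / n : ℝ) := Finset.sum_le_sum fun _ _ => (hF _).2
      _ = 1 := by simp [hn'.ne']
  have hZabs (h) : |Z h| ≤ 1 := abs_le.2 ⟨by linarith [hZ0 h], hZ1 h⟩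
  have haZ (h) : |a * Z h| ≤ |a| := by
    rw [abs_mul]
    exact mul_le_of_le_one_right (abs_nonneg _) (hZabs h)
  have hmean (ρ : Fin K → ℝ≥0) : ∫ h, Z h ∂(histLaw γ π ρ n) =
      ∑ g ∈ optimalVectors γ lam, expectedPlays γ π ρ n g / n := by
    rw [integral_sum_eq_sum_expectedPlays γ π ρ n F,
      ← Finset.sum_subset (optimalVectors_subset γ lam)]
    · exact Finset.sum_congr rfl fun g hg => by simp [F, hg, div_eq_mul_inv]
    · intro g _ hg
      simp [F, hg]
  -- A vector of J(λ) detects only in cells of I(λ), where the divergence is zero.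
  have hD : ∑ g ∈ optimalVectors γ lam,
      expectedPlays γ π lam n g * ∑ k, (g k : ℝ) * realKL (lam k) (θ k) = 0 := by
    refine Finset.sum_eq_zero fun g hg => mul_eq_zero_of_right _ <|
      Finset.sum_eq_zero fun k _ => ?_
    rcases eq_or_ne (g k) 0 with h0 | h0
    · simp [h0]
    · rw [hI k ⟨g, hg, pos_iff_ne_zero.2 h0⟩, realKL]
      rcases eq_or_ne (lam k) 0 with h1 | h1 <;> simp [h1]
  have key := entropyBound_histLaw γ π hθ n (fun h => a * Z h) ⟨|a|, haZ⟩
  rw [integral_const_mul, hmean, integral_sum_eq_sum_expectedPlays γ π lam n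
      fun g => ∑ k, (g k : ℝ) * realKL (lam k) (θ k),
    ← sum_suboptimal_add_sum_optimal γ lam, hD, add_zero] at key
  have hsum : 1 - ∑ g ∈ suboptimalVectors γ lam, expectedPlays γ π lam n g / n =
      ∑ g ∈ optimalVectors γ lam, expectedPlays γ π lam n g / n := by
    rw [sub_eq_iff_eq_add', sum_suboptimal_add_sum_optimal, ← Finset.sum_div,
      sum_expectedPlays, div_self hn'.ne']
  rw [hsum]
  refine key.trans (add_le_add_right (Real.log_le_log
    ((Real.exp_pos _).trans_le (exp_neg_le_integral_exp haZ)) ?_) _)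
  rw [← hmean θ, ← integral_const_mul]
  have hint : Integrable (fun h => Real.exp a * Z h) (histLaw γ π θ n) :=
    (integrable_of_abs_le hZabs).const_mul _
  have h1 := integral_mono (integrable_exp_of_abs_le haZ)
    ((integrable_const (1 : ℝ)).add hint) fun h => exp_mul_le_one_add (hZ0 h) (hZ1 h)
  rw [integral_add' (integrable_const _) hint] at h1
  simpa using h1

/-- The plays of the suboptimal vectors separate `lam` from every `θ` in `B(lam)`. -/
lemma one_le_sum_of_tendsto {R : Set ℝ≥0} {γ : Detection K U} {π : Policy K U}
    (hπ : IsUniformlyGood R γ π) {lam θ : Fin K → ℝ≥0} (hlam : ∀ k, lam k ∈ R)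
    (hθ : θ ∈ confusingRates R γ lam) (hac : ∀ k, θ k = 0 → lam k = 0) {l : Filter ℕ} [l.NeBot]
    (hl : l ≤ atTop) {d : (Fin K → unitInterval) → ℝ}
    (hd : ∀ g ∈ suboptimalVectors γ lam,
      Tendsto (fun n : ℕ => expectedPlays γ π lam n g / Real.log n) l (nhds (d g))) :
    1 ≤ ∑ g ∈ suboptimalVectors γ lam, d g * ∑ k, (g k : ℝ) * realKL (lam k) (θ k) := by
  obtain ⟨hθR, hθJ, hθI⟩ := hθ
  refine le_of_forall_pos_sub_le fun α hα => ?_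
  have hlog : Tendsto (fun n : ℕ => Real.log n) atTop atTop :=
    Real.tendsto_log_atTop.comp tendsto_natCast_atTop_atTop
  have hL : Tendsto (fun n : ℕ => (1 - α) *
      (1 - ∑ g ∈ suboptimalVectors γ lam, expectedPlays γ π lam n g / n)) l
      (nhds ((1 - α) * (1 - ∑ g ∈ suboptimalVectors γ lam, 0))) := by
    refine (tendsto_const_nhds.sub (tendsto_finsetSum _ fun g hg => ?_)).const_mul _
    obtain ⟨hg, hgap⟩ := mem_suboptimalVectors.1 hg
    have := (hπ lam hlam g hg hgap 1 one_pos).tendsto_div_nhds_zero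
    simp only [Real.rpow_one] at this
    exact this.mono_left hl
  have hR : Tendsto (fun n : ℕ => ∑ g ∈ suboptimalVectors γ lam,
        expectedPlays γ π lam n g / Real.log n * ∑ k, (g k : ℝ) * realKL (lam k) (θ k) +
      Real.log 2 / Real.log n) l (nhds (∑ g ∈ suboptimalVectors γ lam,
        d g * ∑ k, (g k : ℝ) * realKL (lam k) (θ k) + 0)) :=
    (tendsto_finsetSum _ fun g hg => (hd g hg).mul_const _).add
      ((tendsto_const_nhds.div_atTop hlog).mono_left hl)
  -- Vectors of J(λ) are suboptimal for θ, so uniform goodness under θ applies to them.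
  have hJ : Tendsto (fun n : ℕ => ∑ g ∈ optimalVectors γ lam,
      expectedPlays γ π θ n g / (n : ℝ) ^ α) atTop
      (nhds (∑ g ∈ optimalVectors γ lam, 0)) :=
    tendsto_finsetSum _ fun g hg => (hπ θ hθR g (optimalVectors_subset γ lam hg)
      (sub_pos.2 (hθJ g hg)) α hα).tendsto_div_nhds_zero
  rw [Finset.sum_const_zero] at hJ hL
  rw [sub_zero, mul_one] at hL
  rw [add_zero] at hR
  refine le_of_tendsto_of_tendsto hL hR (hl ?_)
  filter_upwards [hJ.eventually_le_const one_pos, eventually_ge_atTop 2] with n hn hn2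
  have hn0 : (0 : ℝ) < n := by positivity
  have hlogn : 0 < Real.log n := Real.log_pos (by exact_mod_cast hn2)
  -- This multiplier gives exp(a)/n = n^(-α), so the logarithm on the right stays below log 2.
  have key := mul_one_sub_le γ π hac hθI (n := n) (by omega) ((1 - α) * Real.log n)
  have hexp : Real.exp ((1 - α) * Real.log n) *
      ∑ g ∈ optimalVectors γ lam, expectedPlays γ π θ n g / n =
      ∑ g ∈ optimalVectors γ lam, expectedPlays γ π θ n g / (n : ℝ) ^ α := by
    rw [mul_comm (1 - α), ← Real.rpow_def_of_pos hn0, Real.rpow_sub hn0, Real.rpow_one,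
      Finset.mul_sum]
    refine Finset.sum_congr rfl fun g _ => ?_
    field_simp
  rw [hexp] at key
  have hlog2 : Real.log (1 + ∑ g ∈ optimalVectors γ lam,
      expectedPlays γ π θ n g / (n : ℝ) ^ α) ≤ Real.log 2 := by
    refine Real.log_le_log (add_pos_of_pos_of_nonneg one_pos (Finset.sum_nonneg fun g _ =>
      div_nonneg (expectedPlays_nonneg _ _ _ _ _) (by positivity))) (by linarith)
  have key' := (div_le_div_iff_of_pos_right hlogn).2 (key.trans (add_le_add_right hlog2 _))
  rw [add_div, Finset.sum_div] at key'
  calc _ = (1 - α) * Real.log n * (1 - ∑ g ∈ suboptimalVectors γ lam,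
        expectedPlays γ π lam n g / n) / Real.log n := by field_simp
    _ ≤ _ := key'
    _ = _ := by
      congr 1
      exact Finset.sum_congr rfl fun g _ => by ring

/-! ### Feasibility -/

/-- For y > 0 the divergence is y · `klFun` (x / y). -/
lemma realKL_nonneg {x y : ℝ≥0} (h : y = 0 → x = 0) : 0 ≤ realKL x y := by
  rcases eq_or_ne y 0 with rfl | hy
  · simp [realKL, h rfl]
  · have hy' : (0 : ℝ) < y := by positivity
    have := mul_nonneg hy'.le (InformationTheory.klFun_nonneg (x := x / y) (by positivity))
    rw [InformationTheory.klFun_apply] at this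
    rw [realKL]
    field_simp at this
    linarith

lemma poissonKL_eq_ofReal {x y : ℝ≥0} (h : y = 0 → x = 0) :
    poissonKL x y = ENNReal.ofReal (realKL x y) := by
  rw [poissonKL, if_neg fun hxy => hxy.2 (h hxy.1), realKL]

lemma reward_mono {lam θ : Fin K → ℝ≥0} (h : lam ≤ θ) (g : Fin K → unitInterval) :
    reward lam g ≤ reward θ g :=
  Finset.sum_le_sum fun k _ => mul_le_mul_of_nonneg_left (by exact_mod_cast h k) (g k).2.1

lemma opt_mono (γ : Detection K U) {lam θ : Fin K → ℝ≥0} (h : lam ≤ θ) :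
    opt γ lam ≤ opt γ θ :=
  ciSup_mono (Set.finite_range _).bddAbove fun _ => reward_mono h _

/-- Raising rates in cells outside `I(lam)` does not lead out of `B(lam)`. -/
lemma confusingRates_of_le {R : Set ℝ≥0} {γ : Detection K U} {lam θ θ' : Fin K → ℝ≥0}
    (hθ : θ ∈ confusingRates R γ lam) (hR : ∀ k, θ' k ∈ R) (hle : θ ≤ θ')
    (hI : ∀ k ∈ optimalCells γ lam, θ' k = θ k) : θ' ∈ confusingRates R γ lam := by
  obtain ⟨-, hθJ, hθI⟩ := hθ
  refine ⟨hR, fun g hg => ?_, fun k hk => (hI k hk).trans (hθI k hk)⟩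
  -- Vectors of J(λ) do not see the raised cells, while the optimum can only increase.
  have : reward θ' g = reward θ g := by
    refine Finset.sum_congr rfl fun k _ => ?_
    rcases eq_or_ne (g k) 0 with h0 | h0
    · simp [h0]
    · rw [hI k ⟨g, hg, pos_iff_ne_zero.2 h0⟩]
  rw [this]
  exact (hθJ g hg).trans_le (opt_mono γ hle)

/-- It remains to treat θ with θ_k = 0 < λ_k. If a vector with d_g > 0 detects in such a cell, the
constraint sum is infinite; otherwise these rates do not affect the sum and may be made positive. -/
lemma isFeasible_of_tendsto {R : Set ℝ≥0} (hR1 : 1 ∈ R) {γ : Detection K U} {π : Policy K U}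
    (hπ : IsUniformlyGood R γ π) {lam : Fin K → ℝ≥0} (hlam : ∀ k, lam k ∈ R) {l : Filter ℕ}
    [l.NeBot] (hl : l ≤ atTop) {d : (Fin K → unitInterval) → ℝ≥0}
    (hd : ∀ g ∈ suboptimalVectors γ lam,
      Tendsto (fun n : ℕ => expectedPlays γ π lam n g / Real.log n) l (nhds (d g))) :
    IsFeasible R γ lam d := by
  classical
  refine le_iInf₂ fun θ hθ => ?_
  by_cases htop : ∃ g ∈ suboptimalVectors γ lam, d g ≠ 0 ∧ ∃ k, g k ≠ 0 ∧ θ k = 0 ∧ lam k ≠ 0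
  · obtain ⟨g, hg, hdg, k, hgk, hθk, hlk⟩ := htop
    have hk : ENNReal.ofReal (g k : ℝ) * poissonKL (lam k) (θ k) = ⊤ := by
      rw [poissonKL, if_pos ⟨hθk, hlk⟩, ENNReal.mul_top]
      exact (ENNReal.ofReal_pos.2 (unitInterval.pos_iff_ne_zero.2 hgk)).ne'
    have hs : ∑ k, ENNReal.ofReal (g k : ℝ) * poissonKL (lam k) (θ k) = ⊤ :=
      ENNReal.sum_eq_top.2 ⟨k, Finset.mem_univ k, hk⟩
    have : ∑ g ∈ suboptimalVectors γ lam, (d g : ℝ≥0∞) *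
        ∑ k, ENNReal.ofReal (g k : ℝ) * poissonKL (lam k) (θ k) = ⊤ :=
      ENNReal.sum_eq_top.2 ⟨g, hg, by rw [hs, ENNReal.mul_top (by exact_mod_cast hdg)]⟩
    rw [this]
    exact le_top
  push Not at htop
  -- The value 1 is arbitrary: any positive rate lying in `R` removes the infinite divergence.
  let θ' : Fin K → ℝ≥0 := fun k => if θ k = 0 ∧ lam k ≠ 0 then 1 else θ k
  have hac (k) (h : θ' k = 0) : lam k = 0 := by
    by_contra hk
    by_cases h0 : θ k = 0 <;> simp_all [θ']
  have hθ' : θ' ∈ confusingRates R γ lam := by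
    refine confusingRates_of_le hθ (fun k => ?_) (fun k => ?_) fun k hk => ?_
    · simp only [θ']
      split_ifs
      exacts [hR1, hθ.1 k]
    · simp only [θ']
      split_ifs with h
      · simp [h.1]
      · exact le_rfl
    · simp only [θ']
      rw [if_neg]
      rintro ⟨h0, h1⟩
      exact h1 ((hθ.2.2 k hk).symm.trans h0)
  have key := one_le_sum_of_tendsto hπ hlam hθ' hac hl hd
  have hterm (g : Fin K → unitInterval) (k : Fin K) :
      0 ≤ (g k : ℝ) * realKL (lam k) (θ' k) :=
    mul_nonneg (g k).2.1 (realKL_nonneg (hac k))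
  have key' := ENNReal.ofReal_le_ofReal key
  rw [ENNReal.ofReal_one] at key'
  refine key'.trans_eq ?_
  have hsum (g : Fin K → unitInterval) :
      0 ≤ (d g : ℝ) * ∑ k, (g k : ℝ) * realKL (lam k) (θ' k) :=
    mul_nonneg (d g).coe_nonneg (Finset.sum_nonneg fun k _ => hterm g k)
  rw [ENNReal.ofReal_sum_of_nonneg fun g _ => hsum g]
  refine Finset.sum_congr rfl fun g hg => ?_
  rw [ENNReal.ofReal_mul (d g).coe_nonneg, ENNReal.ofReal_coe_nnreal]
  rcases eq_or_ne (d g) 0 with h0 | h0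
  · simp [h0]
  rw [ENNReal.ofReal_sum_of_nonneg fun k _ => hterm g k]
  congr 1
  refine Finset.sum_congr rfl fun k _ => ?_
  rw [ENNReal.ofReal_mul (g k).2.1]
  rcases eq_or_ne (g k) 0 with hk | hk
  · simp [hk]
  have hk' := htop g hg h0 k hk
  rw [poissonKL_eq_ofReal hk']
  simp only [θ']
  rw [if_neg fun h => h.2 (hk' h.1)]

end Surveillance

end

/-! ### The lower bound, by compactness. -/

theorem theorem2 {K U : ℕ} (γ : Surveillance.Detection K U)
    (R : Set ℝ≥0) (hR : R = Set.univ ∨ R = Set.Ioi 0)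
    (π : Surveillance.Policy K U) (hπ : Surveillance.IsUniformlyGood R γ π)
    (lam : Fin K → ℝ≥0) (hlam : ∀ k, lam k ∈ R)
    (hB : (Surveillance.confusingRates R γ lam).Nonempty) :
    Surveillance.lowerBoundConstant R γ lam ≤
      liminf (fun n : ℕ => ((Surveillance.regret γ π lam n / Real.log n : ℝ) : EReal)) atTop := by
  open Surveillance in
  by_contra! hlt
  obtain ⟨b, hb1, hb2⟩ := EReal.lt_iff_exists_real_btwn.1 hlt
  have hfreq : ∃ᶠ n : ℕ in atTop, regret γ π lam n / Real.log n < b :=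
    (frequently_lt_of_liminf_lt (by isBoundedDefault) hb1).mono fun n hn => by exact_mod_cast hn
  have : (atTop ⊓ 𝓟 {n : ℕ | regret γ π lam n / Real.log n < b}).NeBot :=
    frequently_mem_iff_neBot.1 hfreq
  -- Along an ultrafilter carried by the horizons with small regret, all normalised play counts
  -- converge at once, without extracting subsequences.
  let V := Ultrafilter.of (atTop ⊓ 𝓟 {n : ℕ | regret γ π lam n / Real.log n < b})
  have hV : (V : Filter ℕ) ≤ atTop := (Ultrafilter.of_le _).trans inf_le_left
  have hVb : ∀ᶠ n in (V : Filter ℕ), regret γ π lam n / Real.log n < b :=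
    (Ultrafilter.of_le _).trans inf_le_right (mem_principal_self _)
  have hterm (n : ℕ) (g) (hg : g ∈ suboptimalVectors γ lam) :
      0 ≤ expectedPlays γ π lam n g / Real.log n * gap γ lam g :=
    mul_nonneg (div_nonneg (expectedPlays_nonneg _ _ _ _ _) (Real.log_natCast_nonneg n))
      (mem_suboptimalVectors.1 hg).2.le
  have hreg (n : ℕ) : regret γ π lam n / Real.log n = ∑ g ∈ suboptimalVectors γ lam,
      expectedPlays γ π lam n g / Real.log n * gap γ lam g := by
    rw [regret_eq, Finset.sum_div]
    exact Finset.sum_congr rfl fun g _ => by ring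
  have hlim (g) (hg : g ∈ suboptimalVectors γ lam) : ∃ x : ℝ≥0,
      Tendsto (fun n : ℕ => expectedPlays γ π lam n g / Real.log n) V (nhds (x : ℝ)) := by
    have hgap := (mem_suboptimalVectors.1 hg).2
    -- A positive gap turns the regret bound into a bound on the plays of each single suboptimal
    -- vector.
    have hmem : ∀ᶠ n : ℕ in (V : Filter ℕ),
        expectedPlays γ π lam n g / Real.log n ∈ Set.Icc 0 (b / gap γ lam g) := by
      filter_upwards [hVb] with n hn
      refine ⟨div_nonneg (expectedPlays_nonneg _ _ _ _ _) (Real.log_natCast_nonneg n), ?_⟩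
      rw [le_div_iff₀ hgap]
      refine le_trans ?_ hn.le
      rw [hreg]
      exact Finset.single_le_sum (hterm n) hg
    obtain ⟨x, hx, hxl⟩ := isCompact_Icc.ultrafilter_le_nhds
      (V.map fun n : ℕ => expectedPlays γ π lam n g / Real.log n) (le_principal_iff.2 hmem)
    exact ⟨⟨x, hx.1⟩, hxl⟩
  choose! d hd using hlim
  have hfeas : IsFeasible R γ lam d :=
    isFeasible_of_tendsto (by rcases hR with rfl | rfl <;> simp) hπ hlam hV hd
  have hle : ∑ g ∈ suboptimalVectors γ lam, (d g : ℝ) * gap γ lam g ≤ b := by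
    refine le_of_tendsto (tendsto_finsetSum _ fun g hg => (hd g hg).mul_const (gap γ lam g)) ?_
    filter_upwards [hVb] with n hn
    rw [← hreg]
    exact hn.le
  -- The limit `d` is feasible with cost at most b, which is below the optimal value.
  exact absurd ((iInf₂_le d hfeas).trans (EReal.coe_le_coe_iff.2 hle)) (not_le.2 hb2)
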